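/- Let $K$ be a field of characteristic $0$, let $n\ge 1$, and let $K(\mathbf q)$ be the field of rational functions over $K$ in variables $q_1,\dots,q_n$ subject only to the relation $q_1q_2\cdots q_n=1$, i.e. the fraction field of the integral domain $K[q_1,\dots,q_n]/(q_1\cdots q_n-1)$. The symmetric group $S_n$ acts on $K(\mathbf q)$ from the left by $\sigma[f](q_1,\dots,q_n)=f(q_{\sigma(1)},\dots,q_{\sigma(n)})$. Let $K(\mathbf q)S_n$ be the $K(\mathbf q)$-vector space with basis $S_n$, equipped with the twisted product $\ltimes$, the biadditive product with $$ f\sigma\ltimes g\tau=(f\cdot\sigma[g])\,\sigma\tau\qquad(f,g\in K(\mathbf q),\ \sigma,\tau\in S_n), $$ where $\sigma\tau$ is composition from right to left. Let $\mathcal L_{K(\mathbf q)}(\{1,\dots,n\})$ be the smallest $K(\mathbf q)$-subspace of the free associative algebra $K(\mathbf q)\langle 1,\dots,n\rangle$ that contains the letters $1,\dots,n$ and is closed under the bracket $[a,b]=ab-ba$. Identify $\sigma\in S_n$ with the word $\sigma(1)\sigma(2)\cdots\sigma(n)$, so that $K(\mathbf q)S_n$ becomes a subspace of $K(\mathbf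 q)\langle 1,\dots,n\rangle$, and put $\mathcal L_n(\mathbf q)=K(\mathbf q)S_n\cap\mathcal L_{K(\mathbf q)}(\{1,\dots,n\})$ (the Lie elements). An element $\pi\in K(\mathbf q)S_n$ is called a Lie idempotent if $\pi\ltimes\pi=\pi$ and $K(\mathbf q)S_n\ltimes\pi=\mathcal L_n(\mathbf q)$. For $\sigma\in S_n$ let $D(\sigma)=\{j : 1\le j\le n-1,\ \sigma(j)>\sigma(j+1)\}$ and $$ \mathrm{maj}_{\mathbf q}(\sigma)=\frac{\prod_{j\in D(\sigma)}q_{\sigma(1)}q_{\sigma(2)}\cdots q_{\sigma(j)}}{\prod_{i=1}^{n-1}\bigl(1-q_{\sigma(1)}q_{\sigma(2)}\cdots q_{\sigma(i)}\bigr)},\qquad e_n(\mathbf q)=\sum_{\sigma\in S_n}\mathrm{maj}_{\mathbf q}(\sigma)\,\sigma . $$ Then $e_n(\mathbf q)$ is a Lie idempotent; that is, $e_n(\mathbf q)\ltimes e_n(\mathbf q)=e_n(\mathbf q)$ and the left ideal $K(\mathbf q)S_n\ltimes e_n(\mathbf q)$ is equal to $\mathcal L_n(\mathbf q)$. -/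

import Mathlib

noncomputable section

namespace KlyachkoIdem

universe u

/-- The relation `q_1 q_2 ⋯ q_n = 1`, as an ideal of `K[q_1, …, q_n]`. -/
def relIdeal (K : Type u) [Field K] (n : ℕ) : Ideal (MvPolynomial (Fin n) K) :=
  Ideal.span {(∏ i, MvPolynomial.X i) - 1}

theorem relIdeal_isPrime (K : Type u) [Field K] (n : ℕ) : (relIdeal K n).IsPrime := by
  classical
  rcases Nat.eq_zero_or_pos n with rfl | hn
  · have h : relIdeal K 0 = ⊥ := by simp [relIdeal]
    rw [h]
    exact Ideal.isPrime_bot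
  · obtain ⟨m, rfl⟩ : ∃ m, n = m + 1 := ⟨n - 1, by omega⟩
    have hirr : Irreducible
        ((∏ i : Fin m, (MvPolynomial.X i.succ : MvPolynomial (Fin (m + 1)) K)) *
          MvPolynomial.X 0 + (-1)) := by
      apply MvPolynomial.irreducible_mul_X_add
      · exact Finset.prod_ne_zero_iff.mpr fun i _ => MvPolynomial.X_ne_zero _
      · intro h0
        have h1 := MvPolynomial.vars_prod
          (fun i : Fin m => (MvPolynomial.X i.succ : MvPolynomial (Fin (m + 1)) K)) h0
        simp only [Finset.mem_biUnion, MvPolynomial.vars_X, Finset.mem_singleton] at h1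
        obtain ⟨i, _, hi⟩ := h1
        exact (Fin.succ_ne_zero i) hi.symm
      · simp
      · exact isUnit_one.neg.isRelPrime_right
    have heq : (∏ i, (MvPolynomial.X i : MvPolynomial (Fin (m + 1)) K)) - 1 =
        (∏ i : Fin m, (MvPolynomial.X i.succ : MvPolynomial (Fin (m + 1)) K)) *
          MvPolynomial.X 0 + (-1) := by
      rw [Fin.prod_univ_succ]; ring
    unfold relIdeal
    rw [heq]
    exact (Ideal.span_singleton_prime hirr.ne_zero).mpr hirr.prime

/-- The coordinate ring `K[q_1, …, q_n] / (q_1 ⋯ q_n - 1)`. -/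
abbrev CoordRing (K : Type u) [Field K] (n : ℕ) : Type u :=
  MvPolynomial (Fin n) K ⧸ relIdeal K n

instance instIsDomainCoordRing (K : Type u) [Field K] (n : ℕ) : IsDomain (CoordRing K n) :=
  (Ideal.Quotient.isDomain_iff_prime _).mpr (relIdeal_isPrime K n)

/-- The field `K(q)` of rational functions in `q_1, …, q_n` subject only to
`q_1 q_2 ⋯ q_n = 1`. -/
def QField (K : Type u) [Field K] (n : ℕ) : Type u := FractionRing (CoordRing K n)

instance instFieldQField (K : Type u) [Field K] (n : ℕ) : Field (QField K n) :=
  inferInstanceAs (Field (FractionRing (CoordRing K n)))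

instance instAlgebraQField (K : Type u) [Field K] (n : ℕ) :
    Algebra (CoordRing K n) (QField K n) :=
  inferInstanceAs (Algebra (CoordRing K n) (FractionRing (CoordRing K n)))

instance instIsFractionRingQField (K : Type u) [Field K] (n : ℕ) :
    IsFractionRing (CoordRing K n) (QField K n) :=
  inferInstanceAs (IsFractionRing (CoordRing K n) (FractionRing (CoordRing K n)))

/-- The variable `q_i` in `K(q)`. -/
def q (K : Type u) [Field K] (n : ℕ) (i : Fin n) : QField K n :=
  algebraMap (CoordRing K n) (QField K n) (Ideal.Quotient.mk _ (MvPolynomial.X i))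

theorem relIdeal_map (K : Type u) [Field K] (n : ℕ) (σ : Equiv.Perm (Fin n)) :
    relIdeal K n =
      (relIdeal K n).map ((MvPolynomial.renameEquiv K σ).toRingEquiv :
        MvPolynomial (Fin n) K →+* MvPolynomial (Fin n) K) := by
  unfold relIdeal
  rw [Ideal.map_span, Set.image_singleton]
  congr 2
  simp [MvPolynomial.renameEquiv, Equiv.prod_comp σ (fun i => (MvPolynomial.X i :
    MvPolynomial (Fin n) K))]

/-- The substitution `q_i ↦ q_{σ(i)}` on `K[q] / (q_1 ⋯ q_n - 1)`. -/
def coordAct (K : Type u) [Field K] (n : ℕ) (σ : Equiv.Perm (Fin n)) :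
    CoordRing K n ≃+* CoordRing K n :=
  Ideal.quotientEquiv _ _ (MvPolynomial.renameEquiv K σ).toRingEquiv (relIdeal_map K n σ)

/-- The substitution `f(q_1, …, q_n) ↦ f(q_{σ(1)}, …, q_{σ(n)})` on `K(q)`. -/
def fieldAct (K : Type u) [Field K] (n : ℕ) (σ : Equiv.Perm (Fin n)) :
    QField K n ≃+* QField K n :=
  IsFractionRing.ringEquivOfRingEquiv (coordAct K n σ)

theorem coordAct_mk (K : Type u) [Field K] (n : ℕ) (σ : Equiv.Perm (Fin n))
    (p : MvPolynomial (Fin n) K) :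
    coordAct K n σ (Ideal.Quotient.mk _ p) = Ideal.Quotient.mk _ (MvPolynomial.rename σ p) :=
  rfl

theorem fieldAct_algebraMap (K : Type u) [Field K] (n : ℕ) (σ : Equiv.Perm (Fin n))
    (a : CoordRing K n) :
    fieldAct K n σ (algebraMap _ (QField K n) a) = algebraMap _ _ (coordAct K n σ a) :=
  IsFractionRing.ringEquivOfRingEquiv_algebraMap _ _

theorem coordAct_one (K : Type u) [Field K] (n : ℕ) (a : CoordRing K n) :
    coordAct K n 1 a = a := by
  obtain ⟨p, rfl⟩ := Ideal.Quotient.mk_surjective a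
  rw [coordAct_mk, Equiv.Perm.coe_one, MvPolynomial.rename_id_apply]

theorem coordAct_mul (K : Type u) [Field K] (n : ℕ) (σ τ : Equiv.Perm (Fin n))
    (a : CoordRing K n) :
    coordAct K n (σ * τ) a = coordAct K n σ (coordAct K n τ a) := by
  obtain ⟨p, rfl⟩ := Ideal.Quotient.mk_surjective a
  simp only [coordAct_mk, MvPolynomial.rename_rename, Equiv.Perm.coe_mul]

/-- The left action of `S_n` on `K(q)`: `(σ • f)(q_1, …, q_n) = f(q_{σ(1)}, …, q_{σ(n)})`. -/
instance instMulSemiringActionQField (K : Type u) [Field K] (n : ℕ) :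
    MulSemiringAction (Equiv.Perm (Fin n)) (QField K n) where
  smul σ f := fieldAct K n σ f
  one_smul f := by
    change fieldAct K n 1 f = f
    obtain ⟨x, y, -, rfl⟩ := IsFractionRing.div_surjective (CoordRing K n) f
    simp only [map_div₀, fieldAct_algebraMap, coordAct_one]
  mul_smul σ τ f := by
    change fieldAct K n (σ * τ) f = fieldAct K n σ (fieldAct K n τ f)
    obtain ⟨x, y, -, rfl⟩ := IsFractionRing.div_surjective (CoordRing K n) f
    simp only [map_div₀, fieldAct_algebraMap, coordAct_mul]
  smul_zero σ := map_zero (fieldAct K n σ)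
  smul_add σ := map_add (fieldAct K n σ)
  smul_one σ := map_one (fieldAct K n σ)
  smul_mul σ := map_mul (fieldAct K n σ)

theorem smul_q (K : Type u) [Field K] (n : ℕ) (σ : Equiv.Perm (Fin n)) (i : Fin n) :
    σ • q K n i = q K n (σ i) := by
  change fieldAct K n σ (q K n i) = _
  rw [q, fieldAct_algebraMap, coordAct_mk, MvPolynomial.rename_X, q]

/-- `K(q) S_n` with the twisted product
`(f σ) ⋉ (g τ) = (f · (σ • g)) (σ τ)`, extended additively, where `σ τ` is the composition
from right to left. The element `f σ` is `SkewMonoidAlgebra.single σ f`. -/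
abbrev TwistedAlg (K : Type u) [Field K] (n : ℕ) : Type u :=
  SkewMonoidAlgebra (QField K n) (Equiv.Perm (Fin n))

theorem single_mul_single (K : Type u) [Field K] (n : ℕ) (f g : QField K n)
    (σ τ : Equiv.Perm (Fin n)) :
    (SkewMonoidAlgebra.single σ f * SkewMonoidAlgebra.single τ g : TwistedAlg K n) =
      SkewMonoidAlgebra.single (σ * τ) (f * σ • g) :=
  SkewMonoidAlgebra.single_mul_single

/-- The descent set `{j | 1 ≤ j ≤ n - 1, σ(j) > σ(j+1)}`; a position is an element of `Fin n`, so
that the position `j` is represented by `j - 1`. -/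
def descents {n : ℕ} (σ : Equiv.Perm (Fin n)) : Finset (Fin n) :=
  {j | ∃ h : j.val + 1 < n, σ ⟨j.val + 1, h⟩ < σ j}

/-- The product `q_{σ(1)} q_{σ(2)} ⋯ q_{σ(j)}` of the variables at the positions up to and
including `j`. -/
def prefixProd (K : Type u) [Field K] {n : ℕ} (σ : Equiv.Perm (Fin n)) (j : Fin n) :
    QField K n :=
  ∏ k ∈ Finset.Iic j, q K n (σ k)

/-- The `q`-major index
`maj_q(σ) = ∏_{j ∈ D(σ)} q_{σ(1)} ⋯ q_{σ(j)} / ∏_{i=1}^{n-1} (1 - q_{σ(1)} ⋯ q_{σ(i)})`. -/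
def qMaj (K : Type u) [Field K] {n : ℕ} (σ : Equiv.Perm (Fin n)) : QField K n :=
  (∏ j ∈ descents σ, prefixProd K σ j) /
    ∏ i : Fin n with i.val + 1 < n, (1 - prefixProd K σ i)

/-- The multi-parameter Klyachko element `e_n(q) = ∑_σ maj_q(σ) σ`. -/
def klyachko (K : Type u) [Field K] (n : ℕ) : TwistedAlg K n :=
  ∑ σ : Equiv.Perm (Fin n), SkewMonoidAlgebra.single σ (qMaj K σ)

/-- The permutation `σ` as the word `σ(1) σ(2) ⋯ σ(n)` in the free associative algebra on
`{1, …, n}` over `F`. -/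
def permWord (F : Type u) [Field F] {n : ℕ} (σ : Equiv.Perm (Fin n)) : FreeAlgebra F (Fin n) :=
  (List.ofFn fun i => FreeAlgebra.ι F (σ i)).prod

/-- The element `∑_σ f_σ σ` of `K(q) S_n` as an element of the free associative algebra. -/
def toFree (K : Type u) [Field K] (n : ℕ) (x : TwistedAlg K n) :
    FreeAlgebra (QField K n) (Fin n) :=
  ∑ σ : Equiv.Perm (Fin n), x.coeff σ • permWord (QField K n) σ

/-- `𝓛_F(X)`: the smallest vector subspace of the free associative algebra `F⟨X⟩` that contains `X`
and is closed under the bracket `[a, b] = a b - b a`. -/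
def lieSubspace (F : Type u) [Field F] (X : Type*) : Submodule F (FreeAlgebra F X) :=
  sInf {W | (∀ i : X, FreeAlgebra.ι F i ∈ W) ∧ ∀ a ∈ W, ∀ b ∈ W, a * b - b * a ∈ W}

/-- The Lie elements `𝓛_n(q) = K(q) S_n ∩ 𝓛_{K(q)}({1, …, n})`. -/
def lieElements (K : Type u) [Field K] (n : ℕ) : Set (TwistedAlg K n) :=
  {x | toFree K n x ∈ lieSubspace (QField K n) (Fin n)}

/-- `π` is a Lie idempotent of `K(q) S_n` (with the twisted product): it is idempotent, and
`K(q) S_n ⋉ π = 𝓛_n(q)`. -/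
def IsLieIdempotent (K : Type u) [Field K] (n : ℕ) (π : TwistedAlg K n) : Prop :=
  π * π = π ∧ {y : TwistedAlg K n | ∃ x : TwistedAlg K n, y = x * π} = lieElements K n

end KlyachkoIdem

end

noncomputable section

/-! Call a function on `S_n` primitive if its sum over the shuffles of any two complementary
nonempty words is zero (`IsPrim`). A multilinear form of Ree's theorem says that the Lie elements
are exactly the elements with primitive coefficients (`isPrim_of_mem_lieElements`,
`mem_lieElements_of_isPrim`). Two facts then suffice.

Every `x ⋉ e_n` is Lie. Once the last letter is fixed, the major index is multiplicative on shuffles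
(`sum_shuffles_listMaj_cons`); adding up the two possible last letters gives a multiple of `1 - q_1
⋯ q_n = 0` (`sum_shuffles_listMaj`), so `e_n` has primitive coefficients. Left multiplication by `f
τ` relabels the letters and applies an additive map to the coefficients, which preserves primitivity
(`IsPrim.single_mul`).

Every Lie element satisfies `x ⋉ e_n = x` (`mul_klyachko_of_mem_lieElements`). In the coefficient of
`ρ`, the twist turns all prefix products into those of `ρ`, so the summation index `τ` matters only
through `x_τ` and the descents of `τ⁻¹ρ`. Expand the numerator over sets `t` of positions forced to
be ascents: each proper `t` contributes a vanishing shuffle sum (`lieElements_sum_ascents`), and the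
full set leaves `τ = ρ` with a factor that cancels the denominator.

Since `e_n = 1 ⋉ e_n` is Lie, the second fact also gives idempotency. -/

namespace KlyachkoIdem

universe u

/-! ### Lie elements are orthogonal to proper shuffles. -/

section Shuffle

variable {F : Type u} [Field F] {X : Type*}

/-- The algebra homomorphism from `F⟨X⟩` to `F⟨X⟩ ⊗ F⟨X⟩` (realised as a monoid algebra) that sends
a letter in `A` to the first factor and any other letter to the second factor. -/
def splitHom (F : Type u) [Field F] (A : X → Prop) [DecidablePred A] :
    FreeAlgebra F X →ₐ[F] MonoidAlgebra F (FreeMonoid X × FreeMonoid X) :=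
  FreeAlgebra.lift F fun i =>
    MonoidAlgebra.single (if A i then (FreeMonoid.of i, 1) else (1, FreeMonoid.of i)) 1

theorem splitHom_word (A : X → Prop) [DecidablePred A] (l : List X) :
    splitHom F A (l.map (FreeAlgebra.ι F)).prod =
      MonoidAlgebra.single (FreeMonoid.ofList (l.filter (A ·)),
        FreeMonoid.ofList (l.filter (¬ A ·))) 1 := by
  induction l with
  | nil => simp only [List.map_nil, List.prod_nil, map_one]; rfl
  | cons a l ih =>
    rw [List.map_cons, List.prod_cons, map_mul, ih]
    by_cases h : A a <;>
      simp [splitHom, h, MonoidAlgebra.single_mul_single, FreeMonoid.ofList_cons]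

/-- The linear functional on `F⟨X⟩ ⊗ F⟨X⟩` with the values `h` on pairs of words. -/
def pairFunctional (h : List X → List X → F) :
    MonoidAlgebra F (FreeMonoid X × FreeMonoid X) →ₗ[F] F :=
  Finsupp.linearCombination F (fun p => h p.1.toList p.2.toList) ∘ₗ
    (MonoidAlgebra.coeffLinearEquiv F).toLinearMap

theorem pairFunctional_single (h : List X → List X → F) (p : FreeMonoid X × FreeMonoid X) (r : F) :
    pairFunctional h (MonoidAlgebra.single p r) = r * h p.1.toList p.2.toList := by
  simp [pairFunctional]

/-- The inclusion of the first factor. -/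
def leftHom (F : Type u) [Field F] (X : Type*) :
    MonoidAlgebra F (FreeMonoid X) →ₐ[F] MonoidAlgebra F (FreeMonoid X × FreeMonoid X) :=
  MonoidAlgebra.mapDomainAlgHom F F (MonoidHom.inl _ _)

/-- The inclusion of the second factor. -/
def rightHom (F : Type u) [Field F] (X : Type*) :
    MonoidAlgebra F (FreeMonoid X) →ₐ[F] MonoidAlgebra F (FreeMonoid X × FreeMonoid X) :=
  MonoidAlgebra.mapDomainAlgHom F F (MonoidHom.inr _ _)

theorem leftHom_single (u : FreeMonoid X) (r : F) :
    leftHom F X (MonoidAlgebra.single u r) = MonoidAlgebra.single (u, 1) r := by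
  simp [leftHom]

theorem rightHom_single (u : FreeMonoid X) (r : F) :
    rightHom F X (MonoidAlgebra.single u r) = MonoidAlgebra.single (1, u) r := by
  simp [rightHom]

theorem leftHom_mul_rightHom (a b : MonoidAlgebra F (FreeMonoid X)) :
    leftHom F X a * rightHom F X b = rightHom F X b * leftHom F X a := by
  induction a using MonoidAlgebra.induction_linear with
  | zero => simp
  | add a a' h h' => simp [add_mul, mul_add, h, h']
  | single u r =>
    induction b using MonoidAlgebra.induction_linear with
    | zero => simp
    | add a a' h h' => simp only [map_add, add_mul, mul_add, h, h']
    | single v s =>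
      simp [leftHom_single, rightHom_single, MonoidAlgebra.single_mul_single, mul_comm]

/-- The images of the two factors commute, so in a bracket of two sums `left + right` the cross
terms cancel. Such sums therefore pull back to a bracket-closed subspace containing the letters. -/
theorem splitHom_lie (A : X → Prop) [DecidablePred A] {x : FreeAlgebra F X}
    (hx : x ∈ lieSubspace F X) : ∃ a b, splitHom F A x = leftHom F X a + rightHom F X b := by
  let W : Submodule F (FreeAlgebra F X) :=
    ((leftHom F X).toLinearMap.range ⊔ (rightHom F X).toLinearMap.range).comap
      (splitHom F A).toLinearMap
  have hW : ∀ y, y ∈ W ↔ ∃ a b, splitHom F A y = leftHom F X a + rightHom F X b := by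
    intro y
    simp only [W, Submodule.mem_comap, Submodule.mem_sup, LinearMap.mem_range]
    constructor
    · rintro ⟨_, ⟨a, rfl⟩, _, ⟨b, rfl⟩, h⟩
      exact ⟨a, b, h.symm⟩
    · rintro ⟨a, b, h⟩
      exact ⟨_, ⟨a, rfl⟩, _, ⟨b, rfl⟩, h.symm⟩
  rw [← hW]
  refine (Submodule.mem_sInf.mp hx) W ⟨fun i => ?_, fun y hy z hz => ?_⟩
  · rw [hW]
    by_cases h : A i
    · exact ⟨MonoidAlgebra.single (FreeMonoid.of i) 1, 0, by simp [splitHom, h, leftHom_single]⟩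
    · exact ⟨0, MonoidAlgebra.single (FreeMonoid.of i) 1, by simp [splitHom, h, rightHom_single]⟩
  · rw [hW] at hy hz ⊢
    obtain ⟨a, b, h⟩ := hy
    obtain ⟨a', b', h'⟩ := hz
    refine ⟨a * a' - a' * a, b * b' - b' * b, ?_⟩
    have h1 := leftHom_mul_rightHom a b'
    have h2 := leftHom_mul_rightHom a' b
    simp only [map_sub, map_mul, h, h', add_mul, mul_add, h1, h2]
    abel

theorem pairFunctional_splitHom_lie (A : X → Prop) [DecidablePred A] (h : List X → List X → F)
    (hl : ∀ v, h [] v = 0) (hr : ∀ u, h u [] = 0) {x : FreeAlgebra F X}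
    (hx : x ∈ lieSubspace F X) : pairFunctional h (splitHom F A x) = 0 := by
  obtain ⟨a, b, hab⟩ := splitHom_lie A hx
  have h1 : ∀ a, pairFunctional h (leftHom F X a) = 0 := by
    intro a
    induction a using MonoidAlgebra.induction_linear with
    | zero => simp
    | add a a' ih ih' => rw [map_add, map_add, ih, ih', add_zero]
    | single u r => simp [leftHom_single, pairFunctional_single, hr]
  have h2 : ∀ b, pairFunctional h (rightHom F X b) = 0 := by
    intro b
    induction b using MonoidAlgebra.induction_linear with
    | zero => simp
    | add a a' ih ih' => rw [map_add, map_add, ih, ih', add_zero]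
    | single u r => simp [rightHom_single, pairFunctional_single, hl]
  rw [hab, map_add, h1, h2, add_zero]

end Shuffle

/-- The word `σ(1) ⋯ σ(n)` as a list of letters. -/
def word {n : ℕ} (σ : Equiv.Perm (Fin n)) : List (Fin n) := List.ofFn σ

theorem permWord_eq (F : Type u) [Field F] {n : ℕ} (σ : Equiv.Perm (Fin n)) :
    permWord F σ = ((word σ).map (FreeAlgebra.ι F)).prod := by
  rw [permWord, word, List.map_ofFn]; rfl

/-- The working form of orthogonality: any test function of the two restrictions of a word may be
used. Indicators of a pair of words give primitivity; products of order conditions give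
`lieElements_sum_ascents`. -/
theorem lieElements_sum_eq_zero {K : Type u} [Field K] {n : ℕ} {x : TwistedAlg K n}
    (hx : x ∈ lieElements K n) (A : Fin n → Prop) [DecidablePred A]
    (h : List (Fin n) → List (Fin n) → QField K n) (hl : ∀ v, h [] v = 0) (hr : ∀ u, h u [] = 0) :
    ∑ σ, x.coeff σ * h ((word σ).filter (A ·)) ((word σ).filter (¬ A ·)) = 0 := by
  have := pairFunctional_splitHom_lie A h hl hr hx
  rw [toFree, map_sum, map_sum] at this
  rw [← this]
  refine Finset.sum_congr rfl fun σ _ => ?_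
  rw [map_smul, map_smul, permWord_eq, splitHom_word, pairFunctional_single]
  simp

/-- A function on words is primitive if it is orthogonal to all shuffles of complementary nonempty
words. -/
def IsPrim {F : Type u} [Field F] {n : ℕ} (f : Equiv.Perm (Fin n) → F) : Prop :=
  ∀ (A : Fin n → Prop) [DecidablePred A], (∃ a, A a) → (∃ b, ¬ A b) → ∀ σ₀ : Equiv.Perm (Fin n),
    ∑ σ with (word σ).filter (A ·) = (word σ₀).filter (A ·) ∧
      (word σ).filter (¬ A ·) = (word σ₀).filter (¬ A ·), f σ = 0

theorem mem_word {n : ℕ} (σ : Equiv.Perm (Fin n)) (i : Fin n) : i ∈ word σ := by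
  rw [word, List.mem_ofFn]; exact σ.surjective i

theorem isPrim_of_mem_lieElements {K : Type u} [Field K] {n : ℕ} {x : TwistedAlg K n}
    (hx : x ∈ lieElements K n) : IsPrim x.coeff := by
  classical
  rintro A _ ⟨a, ha⟩ ⟨b, hb⟩ σ₀
  have ha' : a ∈ (word σ₀).filter (A ·) := by simp [mem_word, ha]
  have hb' : b ∈ (word σ₀).filter (¬ A ·) := by simp [mem_word, hb]
  have := lieElements_sum_eq_zero hx A
    (fun u v => if u = (word σ₀).filter (A ·) ∧ v = (word σ₀).filter (¬ A ·) then 1 else 0)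
    (fun v => if_neg fun h => by rw [← h.1] at ha'; simp at ha')
    (fun v => if_neg fun h => by rw [← h.2] at hb'; simp at hb')
  simpa [Finset.sum_filter] using this

/-! ### Lie elements with prescribed coefficients on the words with a given first letter. -/

theorem ι_mem_lieSubspace (F : Type u) [Field F] {X : Type*} (i : X) :
    FreeAlgebra.ι F i ∈ lieSubspace F X :=
  Submodule.mem_sInf.mpr fun _ hW => hW.1 i

theorem lieSubspace_bracket {F : Type u} [Field F] {X : Type*} {a b : FreeAlgebra F X}
    (ha : a ∈ lieSubspace F X) (hb : b ∈ lieSubspace F X) : a * b - b * a ∈ lieSubspace F X :=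
  Submodule.mem_sInf.mpr fun W hW =>
    hW.2 a (Submodule.mem_sInf.mp ha W hW) b (Submodule.mem_sInf.mp hb W hW)

/-- Up to words that start with another letter, a word without repetitions is the left-normed
bracket of its letters. -/
theorem exists_bracket (F : Type u) [Field F] {X : Type*} (a : X) (l : List X)
    (hl : (a :: l).Nodup) :
    ∃ y ∈ lieSubspace F X, y - ((a :: l).map (FreeAlgebra.ι F)).prod ∈
      Submodule.span F {z | ∃ b w, b ≠ a ∧ (b :: w).Perm (a :: l) ∧
        z = ((b :: w).map (FreeAlgebra.ι F)).prod} := by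
  induction l using List.reverseRecOn with
  | nil => exact ⟨_, ι_mem_lieSubspace F a, by simp⟩
  | append_singleton l c ih =>
    have hl' : (a :: l).Nodup := by
      rw [← List.cons_append] at hl
      exact hl.of_append_left
    obtain ⟨y, hy, hyr⟩ := ih hl'
    refine ⟨_, lieSubspace_bracket hy (ι_mem_lieSubspace F c), ?_⟩
    have hca : c ≠ a := by
      rintro rfl
      simp at hl
    set S : Set (FreeAlgebra F X) := {z | ∃ b w, b ≠ a ∧ (b :: w).Perm (a :: (l ++ [c])) ∧
        z = ((b :: w).map (FreeAlgebra.ι F)).prod} with hS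
    obtain ⟨r, hr⟩ : ∃ r, r = y - ((a :: l).map (FreeAlgebra.ι F)).prod := ⟨_, rfl⟩
    rw [← hr] at hyr
    have hyw : y = r + ((a :: l).map (FreeAlgebra.ι F)).prod := by rw [hr]; abel
    -- In the expansion of `[y, c]` the only word starting with `a` is the old leading word followed
    -- by `c`. The error terms multiplied by `c` on the right keep their first letter, and all other
    -- terms start with `c`.
    have h1 : r * FreeAlgebra.ι F c ∈ Submodule.span F S := by
      clear hr hyw
      induction hyr using Submodule.span_induction with
      | mem x hx =>
        obtain ⟨b, w, hb, hp, rfl⟩ := hx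
        refine Submodule.subset_span ⟨b, w ++ [c], hb, ?_, ?_⟩
        · simpa using hp.append_right [c]
        · simp [mul_assoc]
      | zero => simp
      | add x y _ _ hx hy => rw [add_mul]; exact add_mem hx hy
      | smul t x _ hx => rw [smul_mul_assoc]; exact Submodule.smul_mem _ _ hx
    have h2 : FreeAlgebra.ι F c * r ∈ Submodule.span F S := by
      clear hr hyw h1
      induction hyr using Submodule.span_induction with
      | mem x hx =>
        obtain ⟨b, w, hb, hp, rfl⟩ := hx
        refine Submodule.subset_span ⟨c, b :: w, hca, ?_, ?_⟩
        · refine (hp.cons c).trans ?_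
          rw [← List.cons_append]
          exact (List.perm_append_singleton c (a :: l)).symm
        · simp
      | zero => simp
      | add x y _ _ hx hy => rw [mul_add]; exact add_mem hx hy
      | smul t x _ hx => rw [mul_smul_comm]; exact Submodule.smul_mem _ _ hx
    have h3 : FreeAlgebra.ι F c * ((a :: l).map (FreeAlgebra.ι F)).prod ∈ Submodule.span F S := by
      refine Submodule.subset_span ⟨c, a :: l, hca, ?_, by simp⟩
      rw [← List.cons_append]
      exact (List.perm_append_singleton c (a :: l)).symm
    have : y * FreeAlgebra.ι F c - FreeAlgebra.ι F c * y -
        ((a :: (l ++ [c])).map (FreeAlgebra.ι F)).prod =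
        r * FreeAlgebra.ι F c - FreeAlgebra.ι F c * r -
          FreeAlgebra.ι F c * ((a :: l).map (FreeAlgebra.ι F)).prod := by
      rw [hyw]
      simp only [List.map_cons, List.map_append, List.map_nil, List.prod_cons, List.prod_append,
        List.prod_nil]
      noncomm_ring
    rw [this]
    exact sub_mem (sub_mem h1 h2) h3

theorem exists_word_eq {n : ℕ} {l : List (Fin n)} (hl : l.Nodup) (hn : l.length = n) :
    ∃ σ : Equiv.Perm (Fin n), word σ = l := by
  have hinj : Function.Injective fun i : Fin n => l.get (i.cast hn.symm) := fun i j h => by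
    have := (List.nodup_iff_injective_get.mp hl) h
    simpa using this
  refine ⟨Equiv.ofBijective _ (Finite.injective_iff_bijective.mp hinj), ?_⟩
  apply List.ext_get
  · simp [word, hn]
  · intro i h1 h2
    simp [word]

theorem word_nodup {n : ℕ} (σ : Equiv.Perm (Fin n)) : (word σ).Nodup :=
  List.nodup_ofFn.mpr σ.injective

theorem length_word {n : ℕ} (σ : Equiv.Perm (Fin n)) : (word σ).length = n := by simp [word]

theorem word_injective {n : ℕ} : Function.Injective (word : Equiv.Perm (Fin n) → _) :=
  fun _ _ h => Equiv.coe_fn_injective (List.ofFn_injective h)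

theorem exists_word_perm {n : ℕ} {l : List (Fin n)} {σ : Equiv.Perm (Fin n)}
    (h : l.Perm (word σ)) : ∃ τ : Equiv.Perm (Fin n), word τ = l :=
  exists_word_eq (h.nodup_iff.mpr (word_nodup σ)) (h.length_eq.trans (length_word σ))

theorem toFree_add {K : Type u} [Field K] {n : ℕ} (x y : TwistedAlg K n) :
    toFree K n (x + y) = toFree K n x + toFree K n y := by
  simp [toFree, add_smul, Finset.sum_add_distrib]

theorem toFree_smul {K : Type u} [Field K] {n : ℕ} (c : QField K n) (x : TwistedAlg K n) :
    toFree K n (c • x) = c • toFree K n x := by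
  simp [toFree, mul_smul, Finset.smul_sum]

theorem toFree_single {K : Type u} [Field K] {n : ℕ} (σ : Equiv.Perm (Fin n)) (c : QField K n) :
    toFree K n (SkewMonoidAlgebra.single σ c) = c • permWord (QField K n) σ := by
  classical
  rw [toFree, Finset.sum_eq_single σ]
  · simp
  · intro τ _ h
    simp [h.symm]
  · simp

theorem toFree_sum {K : Type u} [Field K] {n : ℕ} {ι : Type*} (s : Finset ι)
    (x : ι → TwistedAlg K n) : toFree K n (∑ i ∈ s, x i) = ∑ i ∈ s, toFree K n (x i) := by
  classical
  induction s using Finset.induction_on with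
  | empty => simp [toFree]
  | insert a s ha ih => rw [Finset.sum_insert ha, Finset.sum_insert ha, toFree_add, ih]

/-- Multilinear version of `exists_bracket`. -/
theorem exists_lieElement {K : Type u} [Field K] {m : ℕ} (τ : Equiv.Perm (Fin (m + 1))) :
    ∃ y ∈ lieElements K (m + 1), ∀ σ : Equiv.Perm (Fin (m + 1)), σ 0 = τ 0 →
      y.coeff σ = if σ = τ then 1 else 0 := by
  classical
  have hτ : word τ = τ 0 :: List.ofFn fun i : Fin m => τ i.succ := List.ofFn_succ
  obtain ⟨y, hy, hyr⟩ := exists_bracket (QField K (m + 1)) (τ 0)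
    (List.ofFn fun i : Fin m => τ i.succ) (hτ ▸ word_nodup τ)
  rw [← hτ, ← permWord_eq] at hyr
  -- The error terms are combinations of permutation words, so they lift to `TwistedAlg` without any
  -- coefficient on words starting with `τ 0`.
  have key : ∀ r ∈ Submodule.span (QField K (m + 1)) {z : FreeAlgebra (QField K (m + 1)) _ |
      ∃ b w, b ≠ τ 0 ∧ (b :: w).Perm (word τ) ∧
        z = ((b :: w).map (FreeAlgebra.ι (QField K (m + 1)))).prod},
      ∃ x : TwistedAlg K (m + 1), toFree K (m + 1) x = r ∧
        ∀ σ : Equiv.Perm (Fin (m + 1)), σ 0 = τ 0 → x.coeff σ = 0 := by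
    intro r hr
    induction hr using Submodule.span_induction with
    | mem x hx =>
      obtain ⟨b, w, hb, hp, rfl⟩ := hx
      obtain ⟨ρ, hρ⟩ := exists_word_perm hp
      refine ⟨SkewMonoidAlgebra.single ρ 1, ?_, ?_⟩
      · rw [toFree_single, one_smul, permWord_eq, hρ]
      · intro σ hσ
        rw [SkewMonoidAlgebra.coeff_single_apply, if_neg]
        rintro rfl
        rw [word, List.ofFn_succ] at hρ
        exact hb ((List.cons.inj hρ).1 ▸ hσ)
    | zero => exact ⟨0, by simp [toFree], by simp⟩
    | add r s _ _ hr hs =>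
      obtain ⟨x, hx, hx'⟩ := hr
      obtain ⟨z, hz, hz'⟩ := hs
      exact ⟨x + z, by rw [toFree_add, hx, hz], fun σ hσ => by simp [hx' σ hσ, hz' σ hσ]⟩
    | smul c r _ hr =>
      obtain ⟨x, hx, hx'⟩ := hr
      exact ⟨c • x, by rw [toFree_smul, hx], fun σ hσ => by simp [hx' σ hσ]⟩
  obtain ⟨x, hx, hx'⟩ := key _ hyr
  refine ⟨SkewMonoidAlgebra.single τ 1 + x, ?_, fun σ hσ => ?_⟩
  · change toFree K (m + 1) _ ∈ lieSubspace _ _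
    rw [toFree_add, hx, toFree_single, one_smul]
    simpa using hy
  · rw [SkewMonoidAlgebra.coeff_add, Finsupp.add_apply, hx' σ hσ, add_zero,
      SkewMonoidAlgebra.coeff_single_apply]
    simp only [eq_comm]

/-! ### Primitive elements are Lie. -/

/-- A primitive function that vanishes on the words starting with the letter `a` is zero. -/
theorem IsPrim.eq_zero {F : Type u} [Field F] {m : ℕ} {f : Equiv.Perm (Fin (m + 1)) → F}
    (hf : IsPrim f) (a : Fin (m + 1)) (h0 : ∀ σ : Equiv.Perm (Fin (m + 1)), σ 0 = a → f σ = 0)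
    (σ : Equiv.Perm (Fin (m + 1))) : f σ = 0 := by
  classical
  -- Induction on the number `k` of letters in front of `a`. Among the shuffles of `s` with `a ::
  -- t`, only `s ++ a :: t` has all of `s` in front of `a`; the others have fewer letters there.
  suffices H : ∀ (k : ℕ) (s t : List (Fin (m + 1))) (σ : Equiv.Perm (Fin (m + 1))),
      s.length = k → word σ = s ++ a :: t → f σ = 0 by
    obtain ⟨s, t, h⟩ := List.append_of_mem (mem_word σ a)
    exact H _ s t σ rfl h
  intro k
  induction k using Nat.strong_induction_on with
  | _ k ih =>
    intro s t σ hk hσ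
    have hnd := word_nodup σ
    rw [hσ] at hnd
    rcases s with _ | ⟨b, s'⟩
    · apply h0
      rw [word, List.ofFn_succ] at hσ
      exact (List.cons.inj hσ).1
    set s := b :: s' with hs
    have has : a ∉ s := fun h =>
      (List.disjoint_of_nodup_append hnd) h (List.mem_cons_self)
    have hts : ∀ c ∈ t, c ∉ s := fun c hc h =>
      (List.disjoint_of_nodup_append hnd) h (List.mem_cons_of_mem _ hc)
    have hsum := hf (· ∈ s) ⟨b, by simp [hs]⟩ ⟨a, has⟩ σ
    have hl : (word σ).filter (· ∈ s) = s := by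
      rw [hσ, List.filter_append, List.filter_eq_self.mpr (by simp),
        List.filter_eq_nil_iff.mpr, List.append_nil]
      intro c hc
      rcases List.mem_cons.mp hc with rfl | hc
      · simpa using has
      · simpa using hts c hc
    have hr : (word σ).filter (¬ · ∈ s) = a :: t := by
      rw [hσ, List.filter_append, List.filter_eq_nil_iff.mpr (by simp), List.nil_append,
        List.filter_eq_self.mpr]
      intro c hc
      rcases List.mem_cons.mp hc with rfl | hc
      · simpa using has
      · simpa using hts c hc
    rw [Finset.sum_eq_single_of_mem σ (by simp)] at hsum
    · exact hsum
    intro τ hτ hne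
    rw [Finset.mem_filter, hl, hr] at hτ
    obtain ⟨-, hτl, hτr⟩ := hτ
    obtain ⟨s₁, t₁, h⟩ := List.append_of_mem (mem_word τ a)
    have hndτ := word_nodup τ
    rw [h] at hndτ
    have ha1 : a ∉ s₁ := fun h =>
      (List.disjoint_of_nodup_append hndτ) h (List.mem_cons_self)
    have hs1 : s₁.filter (¬ · ∈ s) = [] := by
      rw [h, List.filter_append, List.filter_cons_of_pos (by simpa using has)] at hτr
      rcases hc : s₁.filter (¬ · ∈ s) with _ | ⟨c, w⟩
      · rfl
      · rw [hc] at hτr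
        have hca : c = a := (List.cons.inj hτr).1
        have : c ∈ s₁.filter (¬ · ∈ s) := by rw [hc]; simp
        exact absurd (hca ▸ (List.mem_filter.mp this).1) ha1
    have hs1' : s₁.filter (· ∈ s) = s₁ := by
      rw [List.filter_eq_self]
      intro c hc
      simpa using List.filter_eq_nil_iff.mp hs1 c hc
    rw [h, List.filter_append, hs1, List.nil_append,
      List.filter_cons_of_pos (by simpa using has)] at hτr
    rw [h, List.filter_append, hs1', List.filter_cons_of_neg (by simpa using has)] at hτl
    refine ih s₁.length ?_ s₁ t₁ τ rfl h
    -- The letters before `a` in `τ` form a prefix of `s`. If it is all of `s`, then `τ = σ`;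
    -- otherwise it is strictly shorter.
    rcases hc : t₁.filter (· ∈ s) with _ | ⟨c, w⟩
    · exfalso
      apply hne
      apply word_injective
      have ht : t₁.filter (¬ · ∈ s) = t₁ := by
        rw [List.filter_eq_self]
        intro c hc'
        simpa using List.filter_eq_nil_iff.mp hc c hc'
      rw [h, hσ, ← (List.cons.inj hτr).2, ht]
      rw [hc, List.append_nil] at hτl
      rw [hτl]
    · have := congrArg List.length hτl
      rw [hc, List.length_append, List.length_cons, hk] at this
      omega

theorem IsPrim.add {F : Type u} [Field F] {n : ℕ} {f g : Equiv.Perm (Fin n) → F}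
    (hf : IsPrim f) (hg : IsPrim g) : IsPrim (f + g) := fun A _ ha hb σ₀ => by
  simp only [Pi.add_apply]
  rw [Finset.sum_add_distrib, hf A ha hb, hg A ha hb, add_zero]

theorem IsPrim.sub {F : Type u} [Field F] {n : ℕ} {f g : Equiv.Perm (Fin n) → F}
    (hf : IsPrim f) (hg : IsPrim g) : IsPrim (f - g) := fun A _ ha hb σ₀ => by
  simp only [Pi.sub_apply]
  rw [Finset.sum_sub_distrib, hf A ha hb, hg A ha hb, sub_zero]

/-- The Lie combination `y` has the same coefficients as `x` on the words starting with `0`. The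
difference is primitive and vanishes there, hence is zero by `IsPrim.eq_zero`. -/
theorem mem_lieElements_of_isPrim {K : Type u} [Field K] {m : ℕ} {x : TwistedAlg K (m + 1)}
    (hx : IsPrim x.coeff) : x ∈ lieElements K (m + 1) := by
  classical
  choose B hB hB' using exists_lieElement (K := K) (m := m)
  set y : TwistedAlg K (m + 1) := ∑ τ with τ 0 = 0, x.coeff τ • B τ with hy
  have hyL : y ∈ lieElements K (m + 1) := by
    change toFree K (m + 1) _ ∈ lieSubspace _ _
    rw [hy, toFree_sum]
    refine Submodule.sum_mem _ fun τ _ => ?_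
    rw [toFree_smul]
    exact Submodule.smul_mem _ _ (hB τ)
  have hxy : x = y := by
    apply SkewMonoidAlgebra.ext
    intro σ
    rw [← sub_eq_zero]
    refine (hx.sub (isPrim_of_mem_lieElements hyL)).eq_zero 0 (fun ρ hρ => ?_) σ
    have hyρ : y.coeff ρ = ∑ τ with τ 0 = 0, x.coeff τ * (B τ).coeff ρ := by
      rw [hy, ← SkewMonoidAlgebra.coeffAddEquiv_apply, map_sum, Finsupp.finsetSum_apply]
      simp
    rw [Pi.sub_apply, hyρ, Finset.sum_eq_single ρ]
    · simp [hB' ρ ρ rfl]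
    · intro τ hτ hne
      rw [hB' τ ρ (hρ.trans (Finset.mem_filter.mp hτ).2.symm), if_neg hne.symm, mul_zero]
    · simp [hρ]
  rw [hxy]; exact hyL

/-! ### Shuffle identities for the major index. -/

section Weight

variable {α : Type*} {F : Type u} [Field F] (q : α → F)

/-- The product of the weights of the letters of a word. -/
def weight (l : List α) : F := (l.map q).prod

theorem weight_append (u v : List α) : weight q (u ++ v) = weight q u * weight q v := by
  simp [weight]

end Weight

section Shuffles

variable {α : Type*} [LinearOrder α]

/-- The embedding that puts a letter in front of a word. -/
def consEmb (a : α) : List α ↪ List α := ⟨List.cons a, List.cons_injective⟩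

/-- The shuffles of two words. -/
def shuffles : List α → List α → Finset (List α)
  | [], v => {v}
  | a :: u, [] => {a :: u}
  | a :: u, b :: v => (shuffles u (b :: v)).map (consEmb a) ∪ (shuffles (a :: u) v).map (consEmb b)
termination_by u v => u.length + v.length

theorem sum_shuffles_cons_cons {F : Type*} [AddCommMonoid F] {a b : α} (hab : a ≠ b)
    (u v : List α) (f : List α → F) :
    ∑ w ∈ shuffles (a :: u) (b :: v), f w =
      ∑ w ∈ shuffles u (b :: v), f (a :: w) + ∑ w ∈ shuffles (a :: u) v, f (b :: w) := by
  rw [shuffles, Finset.sum_union, Finset.sum_map, Finset.sum_map]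
  · rfl
  · rw [Finset.disjoint_left]
    intro w h1 h2
    obtain ⟨w1, -, rfl⟩ := Finset.mem_map.mp h1
    obtain ⟨w2, -, h⟩ := Finset.mem_map.mp h2
    exact hab (List.cons.inj h).1.symm

/-- Links the recursive `shuffles`, suited to induction, with the description by restrictions in
`IsPrim`. -/
theorem mem_shuffles_iff (A : α → Prop) [DecidablePred A] (u v : List α) (hu : ∀ x ∈ u, A x)
    (hv : ∀ x ∈ v, ¬ A x) (w : List α) :
    w ∈ shuffles u v ↔ w.filter (A ·) = u ∧ w.filter (¬ A ·) = v := by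
  induction u, v using shuffles.induct generalizing w with
  | case1 v =>
    rw [shuffles, Finset.mem_singleton]
    constructor
    · rintro rfl
      exact ⟨List.filter_eq_nil_iff.mpr (by simpa using hv),
        List.filter_eq_self.mpr (by simpa using hv)⟩
    · rintro ⟨h1, h2⟩
      rw [← h2, eq_comm, List.filter_eq_self]
      simpa using h1
  | case2 a u =>
    rw [shuffles, Finset.mem_singleton]
    constructor
    · rintro rfl
      exact ⟨List.filter_eq_self.mpr (by simpa using hu),
        List.filter_eq_nil_iff.mpr (by simpa using hu)⟩
    · rintro ⟨h1, h2⟩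
      rw [← h1, eq_comm, List.filter_eq_self]
      simpa using h2
  | case3 a u b v ih1 ih2 =>
    have ha : A a := hu a List.mem_cons_self
    have hb : ¬ A b := hv b List.mem_cons_self
    have ih1 := ih1 (fun x hx => hu x (List.mem_cons_of_mem _ hx)) hv
    have ih2 := ih2 hu (fun x hx => hv x (List.mem_cons_of_mem _ hx))
    rw [shuffles, Finset.mem_union, Finset.mem_map, Finset.mem_map]
    rcases w with _ | ⟨c, w⟩
    · simp [consEmb]
    · by_cases hc : A c
      · have hcb : b ≠ c := by rintro rfl; exact hb hc
        simp only [consEmb, Function.Embedding.coeFn_mk, List.cons.injEq, hcb, false_and, and_false,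
          exists_false, or_false, ih1]
        rw [List.filter_cons_of_pos (by simpa using hc), List.filter_cons_of_neg (by simpa using hc),
          List.cons.injEq]
        constructor
        · rintro ⟨w, h, rfl, rfl⟩
          exact ⟨⟨rfl, h.1⟩, h.2⟩
        · rintro ⟨⟨rfl, h⟩, h'⟩
          exact ⟨w, ⟨h, h'⟩, rfl, rfl⟩
      · have hcb : a ≠ c := by rintro rfl; exact hc ha
        simp only [consEmb, Function.Embedding.coeFn_mk, List.cons.injEq, hcb, false_and, and_false,
          exists_false, false_or, ih2]
        rw [List.filter_cons_of_neg (by simpa using hc), List.filter_cons_of_pos (by simpa using hc),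
          List.cons.injEq]
        constructor
        · rintro ⟨w, h, rfl, rfl⟩
          exact ⟨h.1, rfl, h.2⟩
        · rintro ⟨h, rfl, h'⟩
          exact ⟨w, ⟨h, h'⟩, rfl, rfl⟩

theorem perm_of_mem_shuffles (u v w : List α) (hw : w ∈ shuffles u v) : w.Perm (u ++ v) := by
  induction u, v using shuffles.induct generalizing w with
  | case1 v => rw [shuffles, Finset.mem_singleton] at hw; simp [hw]
  | case2 a u => rw [shuffles, Finset.mem_singleton] at hw; simp [hw]
  | case3 a u b v ih1 ih2 =>
    rw [shuffles, Finset.mem_union, Finset.mem_map, Finset.mem_map] at hw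
    rcases hw with ⟨w, hw, rfl⟩ | ⟨w, hw, rfl⟩
    · exact (ih1 w hw).cons a
    · exact ((ih2 w hw).cons b).trans List.perm_middle.symm

variable {F : Type u} [Field F] (q : α → F)

/-- The `q`-major index of the reverse of a word. -/
def listMaj : List α → F
  | [] => 1
  | [_] => 1
  | a :: b :: l => listMaj (b :: l) / (1 - weight q (b :: l)) *
      if a < b then weight q (b :: l) else 1

theorem weight_eq_of_mem_shuffles {u v w : List α} (hw : w ∈ shuffles u v) :
    weight q w = weight q u * weight q v := by
  rw [← weight_append]
  exact ((perm_of_mem_shuffles u v w hw).map q).prod_eq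

/-- All shuffles of `u` and `v` have the same weight, so the factor contributed by the first letter
is constant and leaves the sum. -/
theorem sum_listMaj_cons_cons (a c : α) (u v : List α) :
    ∑ w ∈ shuffles u v, listMaj q (c :: a :: w) =
      (∑ w ∈ shuffles u v, listMaj q (a :: w)) / (1 - weight q (a :: u) * weight q v) *
        if c < a then weight q (a :: u) * weight q v else 1 := by
  rw [Finset.sum_div, Finset.sum_mul]
  refine Finset.sum_congr rfl fun w hw => ?_
  have h : weight q (a :: w) = weight q (a :: u) * weight q v := by
    have := weight_eq_of_mem_shuffles q hw
    simp only [weight, List.map_cons, List.prod_cons] at this ⊢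
    rw [this, mul_assoc]
  rw [listMaj, h]

theorem sum_listMaj_cons_cons' (b c : α) (u v : List α) :
    ∑ w ∈ shuffles u v, listMaj q (c :: b :: w) =
      (∑ w ∈ shuffles u v, listMaj q (b :: w)) / (1 - weight q u * weight q (b :: v)) *
        if c < b then weight q u * weight q (b :: v) else 1 := by
  rw [sum_listMaj_cons_cons]
  have : weight q (b :: u) * weight q v = weight q u * weight q (b :: v) := by
    simp only [weight, List.map_cons, List.prod_cons]; ring
  rw [this]

/-- Words are reversed, so `c` is the last letter of the original word. Splitting by the letter
after `c` and applying induction to both parts leaves a rational identity in two weights; `c` is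
missing from `u ++ v`, which keeps the denominators nonzero. -/
theorem sum_shuffles_listMaj_cons (hq : ∀ l : List α, l.Nodup → l ≠ [] → (∃ a, a ∉ l) →
      weight q l ≠ 1) (u v : List α) (c : α) (hnd : (c :: (u ++ v)).Nodup) :
    ∑ w ∈ shuffles u v, listMaj q (c :: w) = listMaj q (c :: u) * listMaj q (c :: v) := by
  induction u, v using shuffles.induct generalizing c with
  | case1 v => simp [shuffles, listMaj]
  | case2 a u => simp [shuffles, listMaj]
  | case3 a u b v ih1 ih2 =>
    have hnd' : (a :: u ++ b :: v).Nodup := hnd.of_cons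
    have hnd2 : (b :: (a :: u ++ v)).Nodup := List.perm_middle.nodup_iff.mp hnd'
    have hc : c ∉ a :: u ++ b :: v := (List.nodup_cons.mp hnd).1
    have hab : a ≠ b := by
      rintro rfl
      simp at hnd2
    have hca : c ≠ a := by rintro rfl; simp at hc
    have hcb : c ≠ b := by rintro rfl; simp at hc
    have h1 := hq (a :: u) hnd'.of_append_left (by simp) ⟨c, fun h => hc (by simp_all)⟩
    have h2 := hq (b :: v) hnd'.of_append_right (by simp) ⟨c, fun h => hc (by simp_all)⟩
    have h3 := hq _ hnd' (by simp) ⟨c, hc⟩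
    rw [weight_append] at h3
    rw [sum_shuffles_cons_cons hab, sum_listMaj_cons_cons, sum_listMaj_cons_cons', ih1 a hnd',
      ih2 b hnd2]
    simp only [listMaj]
    generalize weight q (a :: u) = p at *
    generalize weight q (b :: v) = r at *
    generalize listMaj q (a :: u) = x
    generalize listMaj q (b :: v) = y
    have h1' : 1 - p ≠ 0 := sub_ne_zero.mpr h1.symm
    have h2' : 1 - r ≠ 0 := sub_ne_zero.mpr h2.symm
    have h3' : 1 - p * r ≠ 0 := sub_ne_zero.mpr h3.symm
    have h4' : 1 - r * p ≠ 0 := mul_comm p r ▸ h3'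
    -- Of the eight sign patterns two are cyclic and impossible; each of the six orders of `a, b, c`
    -- gives an identity in `p, r, x, y`.
    rcases lt_or_gt_of_ne hab with hab | hab <;> rcases lt_or_gt_of_ne hca with hca | hca <;>
      rcases lt_or_gt_of_ne hcb with hcb | hcb <;>
      first
      | exact absurd (hab.trans hcb) hca.asymm
      | exact absurd (hab.trans hca) hcb.asymm
      | (simp only [hab, hca, hcb, hab.asymm, hca.asymm, hcb.asymm, if_true, if_false]
         field_simp
         ring)

/-- Splitting by the first letter gives `x y (r / (1 - r) + 1 / (1 - p))` if `a < b`, and the same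
with `p, r` exchanged otherwise. Both have numerator `x y (1 - p r)`, and `p r = 1`. -/
theorem sum_shuffles_listMaj (hq : ∀ l : List α, l.Nodup → l ≠ [] → (∃ a, a ∉ l) →
      weight q l ≠ 1) (u v : List α) (hu : u ≠ []) (hv : v ≠ []) (hnd : (u ++ v).Nodup)
    (h : weight q (u ++ v) = 1) : ∑ w ∈ shuffles u v, listMaj q w = 0 := by
  obtain ⟨a, u, rfl⟩ := List.exists_cons_of_ne_nil hu
  obtain ⟨b, v, rfl⟩ := List.exists_cons_of_ne_nil hv
  have hnd2 : (b :: (a :: u ++ v)).Nodup := List.perm_middle.nodup_iff.mp hnd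
  have hab : a ≠ b := by
    rintro rfl
    simp at hnd2
  have hdisj := List.disjoint_of_nodup_append hnd
  have h1 := hq (a :: u) hnd.of_append_left (by simp)
    ⟨b, fun h => hdisj h List.mem_cons_self⟩
  have h2 := hq (b :: v) hnd.of_append_right (by simp)
    ⟨a, fun h => hdisj List.mem_cons_self h⟩
  rw [weight_append] at h
  rw [sum_shuffles_cons_cons hab, sum_shuffles_listMaj_cons q hq _ _ _ hnd,
    sum_shuffles_listMaj_cons q hq _ _ _ hnd2]
  simp only [listMaj]
  generalize weight q (a :: u) = p at *
  generalize weight q (b :: v) = r at *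
  generalize listMaj q (a :: u) = x
  generalize listMaj q (b :: v) = y
  have h1' : 1 - p ≠ 0 := sub_ne_zero.mpr h1.symm
  have h2' : 1 - r ≠ 0 := sub_ne_zero.mpr h2.symm
  rcases lt_or_gt_of_ne hab with hab | hab <;>
    simp only [hab, hab.asymm, if_true, if_false] <;> field_simp <;>
    linear_combination (-x * y) * h

end Shuffles

theorem isPrim_listMaj {F : Type u} [Field F] {n : ℕ} (q : Fin n → F)
    (hq : ∀ l : List (Fin n), l.Nodup → l ≠ [] → (∃ a, a ∉ l) → weight q l ≠ 1)
    (h1 : ∏ i, q i = 1) :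
    IsPrim fun σ : Equiv.Perm (Fin n) => listMaj q (word σ).reverse := by
  rintro A _ ⟨a, ha⟩ ⟨b, hb⟩ σ₀
  set u := (word σ₀).filter (A ·) with hu
  set v := (word σ₀).filter (¬ A ·) with hv
  have huv : (u ++ v).Perm (word σ₀) := by
    have := List.filter_append_perm (fun x => decide (A x)) (word σ₀)
    simpa [hu, hv] using this
  have huv' : (u.reverse ++ v.reverse).Perm (word σ₀) :=
    (u.reverse_perm.append v.reverse_perm).trans huv
  rw [← sum_shuffles_listMaj q hq u.reverse v.reverse]
  · refine Finset.sum_nbij (fun σ => (word σ).reverse) ?_ ?_ ?_ fun σ _ => rfl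
    · intro σ hσ
      rw [Finset.mem_filter] at hσ
      rw [mem_shuffles_iff A, List.filter_reverse, List.filter_reverse, hσ.2.1, hσ.2.2]
      · exact ⟨rfl, rfl⟩
      · intro x; simp [hu]
      · intro x; simp [hv]
    · intro σ _ τ _ h
      exact word_injective (List.reverse_injective h)
    · intro w hw
      rw [Finset.mem_coe] at hw
      have hp := (perm_of_mem_shuffles _ _ _ hw).trans huv'
      obtain ⟨τ, hτ⟩ := exists_word_perm (w.reverse_perm.trans hp)
      refine ⟨τ, ?_, by simp [hτ]⟩
      rw [mem_shuffles_iff A] at hw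
      · simp only [Finset.coe_filter, Finset.mem_univ, true_and, Set.mem_ofPred_eq]
        rw [hτ, List.filter_reverse, List.filter_reverse, hw.1, hw.2, List.reverse_reverse,
          List.reverse_reverse]
        exact ⟨rfl, rfl⟩
      · intro x; simp [hu]
      · intro x; simp [hv]
  · rw [Ne, List.reverse_eq_nil_iff]
    exact List.ne_nil_of_mem (a := a) (by simp [hu, mem_word, ha])
  · rw [Ne, List.reverse_eq_nil_iff]
    exact List.ne_nil_of_mem (a := b) (by simp [hv, mem_word, hb])
  · exact huv'.nodup_iff.mpr (word_nodup σ₀)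
  · rw [weight, (huv'.map q).prod_eq, word, List.map_ofFn, List.prod_ofFn, ← h1]
    exact Equiv.prod_comp σ₀ q

/-! ### The coefficients of the Klyachko element are primitive. -/

theorem prod_q (K : Type u) [Field K] (n : ℕ) : ∏ i, q K n i = 1 := by
  have h : ∏ i, q K n i = algebraMap (CoordRing K n) (QField K n)
      (Ideal.Quotient.mk _ (∏ i, MvPolynomial.X i)) := by
    simp only [q, map_prod]
  rw [h, ← map_one (algebraMap (CoordRing K n) (QField K n)),
    ← map_one (Ideal.Quotient.mk (relIdeal K n))]
  congr 1
  exact Ideal.Quotient.eq.mpr (Ideal.subset_span rfl)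

/-- Evaluate at a point of the hypersurface `q_1 ⋯ q_n = 1`: with `a ∈ l` and `b ∉ l`, put `q_a =
2`, `q_b = 1/2` and all other variables `1`. The weight of `l` becomes `2`. -/
theorem weight_q_ne_one (K : Type u) [Field K] [CharZero K] (n : ℕ) (l : List (Fin n))
    (hl : l.Nodup) (hne : l ≠ []) (hl' : ∃ a, a ∉ l) : weight (q K n) l ≠ 1 := by
  obtain ⟨b, hb⟩ := hl'
  obtain ⟨a, ha⟩ := List.exists_mem_of_ne_nil l hne
  have hab : a ≠ b := by rintro rfl; exact hb ha
  intro h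
  have h1 : weight (q K n) l = algebraMap (CoordRing K n) (QField K n)
      (Ideal.Quotient.mk _ (∏ i ∈ l.toFinset, MvPolynomial.X i)) := by
    rw [weight, ← List.prod_toFinset _ hl, map_prod, map_prod]
    rfl
  rw [h1, ← map_one (algebraMap (CoordRing K n) (QField K n)),
    ← map_one (Ideal.Quotient.mk (relIdeal K n))] at h
  have h2 := Ideal.Quotient.eq.mp (IsFractionRing.injective (CoordRing K n) (QField K n) h)
  let c : Fin n → K := Function.update (Function.update (fun _ => 1) a 2) b 2⁻¹
  have hca : c a = 2 := by simp [c, hab]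
  have hcb : c b = 2⁻¹ := by simp [c]
  have hc : ∀ i, i ≠ a → i ≠ b → c i = 1 := fun i h h' => by simp [c, h, h']
  have hle : relIdeal K n ≤ RingHom.ker (MvPolynomial.eval c) := by
    refine Ideal.span_le.mpr (Set.singleton_subset_iff.mpr ?_)
    change MvPolynomial.eval c _ = 0
    rw [map_sub, map_prod, map_one]
    simp only [MvPolynomial.eval_X]
    rw [← Finset.prod_subset (Finset.subset_univ {a, b}), Finset.prod_pair hab, hca, hcb]
    · simp
    · intro i _ hi
      simp only [Finset.mem_insert, Finset.mem_singleton, not_or] at hi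
      exact hc i hi.1 hi.2
  have h3 : MvPolynomial.eval c _ = 0 := hle h2
  rw [map_sub, map_prod, map_one] at h3
  simp only [MvPolynomial.eval_X] at h3
  rw [Finset.prod_eq_single_of_mem a (by simpa using ha), hca] at h3
  · norm_num at h3
  · intro i hi hia
    exact hc i hia (by rintro rfl; exact hb (by simpa using hi))

theorem reverse_map_range_succ {α : Type*} (s : ℕ → α) (k : ℕ) :
    ((List.range (k + 1)).map s).reverse = s k :: ((List.range k).map s).reverse := by
  simp [List.range_succ]

theorem weight_reverse_map_range {α F : Type*} [Field F] (w : α → F) (s : ℕ → α) (k : ℕ) :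
    weight w ((List.range k).map s).reverse = ∏ i ∈ Finset.range k, w (s i) := by
  induction k with
  | zero => simp [weight]
  | succ k ih =>
    rw [reverse_map_range_succ, Finset.prod_range_succ, ← ih, mul_comm]
    simp [weight]

theorem listMaj_reverse_map_range {α F : Type*} [LinearOrder α] [Field F] (w : α → F) (s : ℕ → α)
    (k : ℕ) : listMaj w ((List.range (k + 1)).map s).reverse = ∏ j ∈ Finset.range k,
      ((if s (j + 1) < s j then ∏ i ∈ Finset.range (j + 1), w (s i) else 1) /
        (1 - ∏ i ∈ Finset.range (j + 1), w (s i))) := by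
  induction k with
  | zero => simp [listMaj]
  | succ k ih =>
    rw [Finset.prod_range_succ, ← ih, reverse_map_range_succ, reverse_map_range_succ, listMaj,
      ← reverse_map_range_succ, weight_reverse_map_range]
    ring

theorem prod_filter_val_succ_lt {M : Type*} [CommMonoid M] {m : ℕ} (g : Fin (m + 1) → M) :
    ∏ i : Fin (m + 1) with i.val + 1 < m + 1, g i = ∏ i : Fin m, g i.castSucc := by
  rw [Finset.prod_filter, Fin.prod_univ_castSucc]
  simp

theorem mem_descents {m : ℕ} (σ : Equiv.Perm (Fin (m + 1))) (i : Fin m) :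
    i.castSucc ∈ descents σ ↔ σ i.succ < σ i.castSucc := by
  rw [descents, Finset.mem_filter]
  constructor
  · rintro ⟨_, _, h⟩; exact h
  · intro h; exact ⟨Finset.mem_univ _, by simp, h⟩

theorem prod_descents {M : Type*} [CommMonoid M] {m : ℕ} (σ : Equiv.Perm (Fin (m + 1)))
    (g : Fin (m + 1) → M) :
    ∏ j ∈ descents σ, g j = ∏ i : Fin m, if σ i.succ < σ i.castSucc then g i.castSucc else 1 := by
  have h : descents σ = ({i | i.val + 1 < m + 1} : Finset (Fin (m + 1))).filter
      (· ∈ descents σ) := by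
    ext j
    simp only [Finset.mem_filter, Finset.mem_univ, true_and, descents]
    constructor
    · rintro ⟨h, h'⟩; exact ⟨h, h, h'⟩
    · exact fun h => h.2
  rw [h, Finset.prod_filter, prod_filter_val_succ_lt]
  simp only [mem_descents]

theorem prefixProd_eq (K : Type u) [Field K] {m : ℕ} (σ : Equiv.Perm (Fin (m + 1))) (i : Fin m) :
    prefixProd K σ i.castSucc =
      ∏ k ∈ Finset.range (i.val + 1), q K (m + 1) (σ (Fin.ofNat (m + 1) k)) := by
  rw [prefixProd]
  refine Finset.prod_nbij Fin.val ?_ ?_ ?_ ?_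
  · intro k hk
    rw [Finset.mem_Iic, Fin.le_def] at hk
    rw [Finset.mem_range]
    exact Nat.lt_succ_of_le hk
  · exact Fin.val_injective.injOn
  · intro k hk
    simp only [Finset.coe_range, Set.mem_Iio] at hk
    have hi := i.isLt
    refine ⟨⟨k, by omega⟩, ?_, rfl⟩
    simp only [Finset.coe_Iic, Set.mem_Iic, Fin.le_def, Fin.val_castSucc]
    omega
  · intro k _
    simp

theorem qMaj_eq (K : Type u) [Field K] {m : ℕ} (σ : Equiv.Perm (Fin (m + 1))) :
    qMaj K σ = (∏ i : Fin m, if σ i.succ < σ i.castSucc then prefixProd K σ i.castSucc else 1) /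
      ∏ i : Fin m, (1 - prefixProd K σ i.castSucc) := by
  rw [qMaj, prod_descents, prod_filter_val_succ_lt]

/-- Indexing by naturals lets the recursion of `listMaj` run over `List.range`; `Fin.ofNat` wraps
modulo `m + 1`, but only indices up to `m` occur. -/
theorem word_eq_map_range {m : ℕ} (σ : Equiv.Perm (Fin (m + 1))) :
    word σ = (List.range (m + 1)).map fun k => σ (Fin.ofNat (m + 1) k) := by
  apply List.ext_get
  · simp [word]
  · intro i h1 h2
    have : i < m + 1 := by simpa [word] using h1
    simp only [word, List.get_eq_getElem, List.getElem_ofFn, List.getElem_map,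
      List.getElem_range]
    congr 1
    ext
    simp [Nat.mod_eq_of_lt this]

theorem listMaj_word (K : Type u) [Field K] {m : ℕ} (σ : Equiv.Perm (Fin (m + 1))) :
    listMaj (q K (m + 1)) (word σ).reverse = qMaj K σ := by
  rw [word_eq_map_range, listMaj_reverse_map_range, Finset.prod_range, qMaj_eq,
    ← Finset.prod_div_distrib]
  refine Finset.prod_congr rfl fun i _ => ?_
  have h1 : Fin.ofNat (m + 1) i.val = i.castSucc := by
    ext; simp
  have h2 : Fin.ofNat (m + 1) (i.val + 1) = i.succ := by
    ext; simp
  rw [prefixProd_eq, h1, h2]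

theorem coeff_klyachko (K : Type u) [Field K] (n : ℕ) (σ : Equiv.Perm (Fin n)) :
    (klyachko K n).coeff σ = qMaj K σ := by
  classical
  rw [klyachko, ← SkewMonoidAlgebra.coeffAddEquiv_apply, map_sum, Finsupp.finsetSum_apply,
    Finset.sum_eq_single σ]
  · simp
  · intro τ _ h
    simp [h.symm]
  · simp

theorem isPrim_klyachko (K : Type u) [Field K] [CharZero K] (m : ℕ) :
    IsPrim (klyachko K (m + 1)).coeff := by
  have h := isPrim_listMaj (q K (m + 1)) (weight_q_ne_one K (m + 1)) (prod_q K (m + 1))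
  have h' : ((klyachko K (m + 1)).coeff : Equiv.Perm (Fin (m + 1)) → QField K (m + 1)) =
      fun σ => listMaj (q K (m + 1)) (word σ).reverse := by
    funext σ
    rw [coeff_klyachko, listMaj_word]
  rw [h']; exact h

/-! ### Left multiples of the Klyachko element are Lie. -/

theorem word_mul {n : ℕ} (τ σ : Equiv.Perm (Fin n)) : word (τ * σ) = (word σ).map τ := by
  rw [word, word, List.map_ofFn]; rfl

theorem IsPrim.single_mul {K : Type u} [Field K] {n : ℕ} {x : TwistedAlg K n} (hx : IsPrim x.coeff)
    (τ : Equiv.Perm (Fin n)) (c : QField K n) :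
    IsPrim (SkewMonoidAlgebra.single τ c * x : TwistedAlg K n).coeff := by
  rintro A _ ⟨a, ha⟩ ⟨b, hb⟩ σ₀
  have h := hx (fun i => A (τ i)) ⟨τ⁻¹ a, by simpa using ha⟩ ⟨τ⁻¹ b, by simpa using hb⟩ (τ⁻¹ * σ₀)
  have key : ∀ (B : Fin n → Prop) [DecidablePred B] (σ : Equiv.Perm (Fin n)),
      (word (τ⁻¹ * σ)).filter (fun i => B (τ i)) = (word (τ⁻¹ * σ₀)).filter (fun i => B (τ i)) ↔
      (word σ).filter (B ·) = (word σ₀).filter (B ·) := by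
    intro B _ σ
    have h : ∀ ρ : Equiv.Perm (Fin n), (word (τ⁻¹ * ρ)).filter (fun i => B (τ i)) =
        ((word ρ).filter (B ·)).map ⇑τ⁻¹ := by
      intro ρ
      rw [word_mul, List.filter_map]
      simp [Function.comp_def]
    rw [h, h, (List.map_injective_iff.mpr (τ⁻¹).injective).eq_iff]
  -- The coefficient of `σ` in the product is `c * τ • x(τ⁻¹σ)`. The map `y ↦ c * τ • y` is
  -- additive, so it carries the vanishing sum for the relabelled predicate `A ∘ τ` to the required
  -- one.
  have h' := congrArg (fun y => c * τ • y) h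
  simp only [smul_zero, mul_zero] at h'
  rw [Finset.smul_sum, Finset.mul_sum] at h'
  rw [← h']
  refine Finset.sum_nbij (τ⁻¹ * ·) ?_ ?_ ?_ ?_
  · intro σ hσ
    rw [Finset.mem_filter] at hσ ⊢
    exact ⟨Finset.mem_univ _, (key A σ).mpr hσ.2.1, (key (fun i => ¬ A i) σ).mpr hσ.2.2⟩
  · exact (mul_right_injective _).injOn
  · intro σ hσ
    refine ⟨τ * σ, ?_, by simp⟩
    simp only [Finset.coe_filter, Finset.mem_univ, true_and, Set.mem_ofPred_eq] at hσ ⊢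
    have e : σ = τ⁻¹ * (τ * σ) := by simp
    rw [e] at hσ
    exact ⟨(key A _).mp hσ.1, (key (fun i => ¬ A i) _).mp hσ.2⟩
  · intro σ _
    rw [SkewMonoidAlgebra.coeff_single_mul]

theorem mul_klyachko_mem_lieElements (K : Type u) [Field K] [CharZero K] (m : ℕ)
    (x : TwistedAlg K (m + 1)) : x * klyachko K (m + 1) ∈ lieElements K (m + 1) := by
  apply mem_lieElements_of_isPrim
  induction x using SkewMonoidAlgebra.induction_on with
  | zero => intro A _ _ _ _; simp
  | single τ c => exact (isPrim_klyachko K m).single_mul τ c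
  | add x y hx hy =>
    rw [add_mul, SkewMonoidAlgebra.coeff_add, Finsupp.coe_add]
    exact hx.add hy

/-! ### Right multiplication by the Klyachko element fixes Lie elements. -/

theorem smul_prefixProd (K : Type u) [Field K] {n : ℕ} (τ σ : Equiv.Perm (Fin n)) (j : Fin n) :
    τ • prefixProd K σ j = prefixProd K (τ * σ) j := by
  simp only [prefixProd, Finset.smul_prod', smul_q, Equiv.Perm.mul_apply]

/-- The twist separates the data: descents remain those of `σ`, while prefix products become those
of `τ * σ`. For `σ = τ⁻¹ρ` the latter no longer depend on `τ`. -/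
theorem smul_qMaj (K : Type u) [Field K] {m : ℕ} (τ σ : Equiv.Perm (Fin (m + 1))) :
    τ • qMaj K σ =
      (∏ i : Fin m, if σ i.succ < σ i.castSucc then prefixProd K (τ * σ) i.castSucc else 1) /
        ∏ i : Fin m, (1 - prefixProd K (τ * σ) i.castSucc) := by
  rw [qMaj_eq, ← MulSemiringAction.toRingHom_apply, map_div₀]
  simp only [MulSemiringAction.toRingHom_apply, Finset.smul_prod', smul_sub, smul_one, smul_ite,
    smul_prefixProd]

theorem pair_sublist_or {α : Type*} {a b : α} (hab : a ≠ b) {l : List α} (ha : a ∈ l) (hb : b ∈ l) :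
    [a, b].Sublist l ∨ [b, a].Sublist l := by
  induction l with
  | nil => simp at ha
  | cons c l ih =>
    rcases List.mem_cons.mp ha with rfl | ha'
    · left
      rcases List.mem_cons.mp hb with rfl | hb'
      · exact absurd rfl hab
      · exact (List.singleton_sublist.mpr hb').cons_cons _
    · rcases List.mem_cons.mp hb with rfl | hb'
      · right
        exact (List.singleton_sublist.mpr ha').cons_cons _
      · exact (ih ha' hb').imp (List.Sublist.cons _) (List.Sublist.cons _)

theorem pair_sublist_word_iff {n : ℕ} (τ : Equiv.Perm (Fin n)) {a b : Fin n} (hab : a ≠ b) :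
    [a, b].Sublist (word τ) ↔ τ⁻¹ a < τ⁻¹ b := by
  have h : (word τ).Pairwise fun a b => τ⁻¹ a < τ⁻¹ b := by
    rw [word, List.pairwise_ofFn]
    intro i j hij
    simpa using hij
  rw [List.pairwise_iff_forall_sublist] at h
  refine ⟨fun h' => h h', fun h' => ?_⟩
  exact (pair_sublist_or hab (mem_word τ a) (mem_word τ b)).resolve_right fun h'' =>
    h'.asymm (h h'')

theorem pair_sublist_filter_iff {α : Type*} (A : α → Prop) [DecidablePred A] {a b : α}
    (hab : A a ↔ A b) (l : List α) :
    [a, b].Sublist l ↔ [a, b].Sublist (l.filter (A ·)) ∨ [a, b].Sublist (l.filter (¬ A ·)) := by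
  constructor
  · intro h
    by_cases ha : A a
    · left
      have := h.filter (fun x => decide (A x))
      simpa [ha, hab.mp ha] using this
    · right
      have hb : ¬ A b := fun hb => ha (hab.mpr hb)
      have := h.filter (fun x => decide (¬ A x))
      simpa [ha, hb] using this
  · rintro (h | h) <;> exact h.trans List.filter_sublist

/-- The coefficients of a Lie element are orthogonal to each shuffle of at least two factors of a
word `ρ`; the factors are cut at the positions outside `t`. -/
theorem lieElements_sum_ascents {K : Type u} [Field K] {m : ℕ} {x : TwistedAlg K (m + 1)}
    (hx : x ∈ lieElements K (m + 1)) (ρ : Equiv.Perm (Fin (m + 1))) (t : Finset (Fin m))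
    (s : Fin m) (hs : s ∉ t) :
    ∑ τ, x.coeff τ * ∏ i ∈ t,
      (if (τ⁻¹ * ρ) i.succ < (τ⁻¹ * ρ) i.castSucc then 0 else 1 : QField K (m + 1)) = 0 := by
  classical
  -- Cut `ρ` after position `s`. For `i ∈ t`, so `i ≠ s`, the letters `ρ i` and `ρ (i+1)` lie on the
  -- same side of the cut, hence their order in `τ` can be read off one of the two restrictions.
  -- Here `(τ⁻¹ * ρ) i` is the position of the letter `ρ i` in `τ`.
  have := lieElements_sum_eq_zero hx (fun i => ρ⁻¹ i ≤ s.castSucc)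
    (fun u v => if u = [] ∨ v = [] then 0 else ∏ i ∈ t,
      if [ρ i.castSucc, ρ i.succ].Sublist u ∨ [ρ i.castSucc, ρ i.succ].Sublist v then 1 else 0)
    (fun v => by simp) (fun u => by simp)
  refine (Finset.sum_congr rfl fun τ _ => ?_).trans this
  rw [if_neg]
  · congr 1
    refine Finset.prod_congr rfl fun i hi => ?_
    have his : i ≠ s := fun h => hs (h ▸ hi)
    have hA : ρ⁻¹ (ρ i.castSucc) ≤ s.castSucc ↔ ρ⁻¹ (ρ i.succ) ≤ s.castSucc := by
      simp only [Equiv.Perm.coe_inv, Equiv.symm_apply_apply, Fin.le_def, Fin.val_castSucc, Fin.val_succ]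
      have : i.val ≠ s.val := fun h => his (Fin.ext h)
      omega
    have hne : ρ i.castSucc ≠ ρ i.succ := fun h => by
      have := congrArg Fin.val (ρ.injective h)
      simp at this
    have hQ : _ ↔ (τ⁻¹ * ρ) i.castSucc < (τ⁻¹ * ρ) i.succ :=
      (pair_sublist_filter_iff (fun i => ρ⁻¹ i ≤ s.castSucc) hA (word τ)).symm.trans
        (pair_sublist_word_iff τ hne)
    have hne' : (τ⁻¹ * ρ) i.castSucc ≠ (τ⁻¹ * ρ) i.succ := fun h => hne (by simpa using h)
    rcases lt_or_gt_of_ne hne' with h | h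
    · rw [if_neg h.asymm, if_pos (hQ.mpr h)]
    · rw [if_pos h, if_neg (mt hQ.mp h.asymm)]
  · rintro (h | h)
    · rw [List.filter_eq_nil_iff] at h
      have := h (ρ s.castSucc) (mem_word τ _)
      simp at this
    · rw [List.filter_eq_nil_iff] at h
      have := h (ρ s.succ) (mem_word τ _)
      simp [Fin.le_def] at this

theorem eq_one_of_forall_lt {m : ℕ} {σ : Equiv.Perm (Fin (m + 1))}
    (h : ∀ i : Fin m, ¬ σ i.succ < σ i.castSucc) : σ = 1 := by
  have hm : StrictMono σ := Fin.strictMono_iff_lt_succ.mpr fun i =>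
    lt_of_le_of_ne (not_lt.mp (h i)) fun h' => by
      have := congrArg Fin.val (σ.injective h')
      simp at this
  apply Equiv.coe_fn_injective
  exact (hm.range_inj strictMono_id).mp (by simp [σ.surjective.range_eq])

theorem prefixProd_ne_one (K : Type u) [Field K] [CharZero K] {m : ℕ}
    (σ : Equiv.Perm (Fin (m + 1))) (i : Fin m) : prefixProd K σ i.castSucc ≠ 1 := by
  have h : prefixProd K σ i.castSucc =
      weight (q K (m + 1)) ((Finset.Iic i.castSucc).toList.map σ) := by
    rw [weight, List.map_map, Finset.prod_map_toList]
    rfl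
  rw [h]
  refine weight_q_ne_one K (m + 1) _ ((Finset.nodup_toList _).map σ.injective) ?_
    ⟨σ (Fin.last m), ?_⟩
  · exact List.ne_nil_of_mem (a := σ i.castSucc) (List.mem_map_of_mem (by simp))
  · simp [Fin.le_def]

theorem mul_klyachko_of_mem_lieElements {K : Type u} [Field K] [CharZero K] {m : ℕ}
    {x : TwistedAlg K (m + 1)} (hx : x ∈ lieElements K (m + 1)) :
    x * klyachko K (m + 1) = x := by
  classical
  apply SkewMonoidAlgebra.ext
  intro ρ
  have hP : ∏ i : Fin m, (1 - prefixProd K ρ i.castSucc) ≠ 0 := by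
    rw [Finset.prod_ne_zero_iff]
    intro i _
    exact sub_ne_zero.mpr (prefixProd_ne_one K ρ i).symm
  rw [SkewMonoidAlgebra.coeff_mul_left, SkewMonoidAlgebra.sum_def,
    Finsupp.sum_fintype _ _ (by simp)]
  simp only [coeff_klyachko, smul_qMaj, mul_inv_cancel_left, ← mul_div_assoc]
  rw [← Finset.sum_div, div_eq_iff hP]
  -- Each numerator factor equals `(1 - P_i) [ascent at i] + P_i`; the product is expanded over the
  -- set `t` of positions where the first term is chosen.
  have hexp : ∀ τ : Equiv.Perm (Fin (m + 1)), (∏ i : Fin m,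
      if (τ⁻¹ * ρ) i.succ < (τ⁻¹ * ρ) i.castSucc then prefixProd K ρ i.castSucc else 1) =
      ∑ t : Finset (Fin m), ((∏ i ∈ t, (1 - prefixProd K ρ i.castSucc)) *
        ∏ i ∈ tᶜ, prefixProd K ρ i.castSucc) *
        ∏ i ∈ t, if (τ⁻¹ * ρ) i.succ < (τ⁻¹ * ρ) i.castSucc then 0 else 1 := by
    intro τ
    have h : ∀ i : Fin m,
        (if (τ⁻¹ * ρ) i.succ < (τ⁻¹ * ρ) i.castSucc then prefixProd K ρ i.castSucc else 1) =
        (1 - prefixProd K ρ i.castSucc) *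
          (if (τ⁻¹ * ρ) i.succ < (τ⁻¹ * ρ) i.castSucc then 0 else 1) +
          prefixProd K ρ i.castSucc := by
      intro i
      split_ifs <;> ring
    simp only [h]
    rw [Fintype.prod_add]
    refine Finset.sum_congr rfl fun t _ => ?_
    rw [Finset.prod_mul_distrib]
    ring
  simp only [hexp, Finset.mul_sum]
  -- Only `t = univ` survives. It forces `τ⁻¹ρ` to have no descent, so `τ = ρ`, and leaves the
  -- product of the `1 - P_i`, which is the denominator.
  rw [Finset.sum_comm, Finset.sum_eq_single Finset.univ]
  · rw [Finset.sum_eq_single ρ]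
    · have h : ∀ i : Fin m, ¬ (ρ⁻¹ * ρ) i.succ < (ρ⁻¹ * ρ) i.castSucc := fun i => by
        simp [Fin.le_def]
      simp only [h, if_false]
      simp
    · intro τ _ hτ
      have : ∃ i : Fin m, (τ⁻¹ * ρ) i.succ < (τ⁻¹ * ρ) i.castSucc := by
        by_contra! h
        have := eq_one_of_forall_lt (σ := τ⁻¹ * ρ) fun i => not_lt.mpr (h i)
        exact hτ (inv_mul_eq_one.mp this)
      obtain ⟨i, hi⟩ := this
      refine mul_eq_zero_of_right _ (mul_eq_zero_of_right _ ?_)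
      exact Finset.prod_eq_zero (Finset.mem_univ i) (if_pos hi)
    · simp
  · intro t _ ht
    obtain ⟨s, hs⟩ : ∃ s, s ∉ t := by
      by_contra! h
      exact ht (Finset.eq_univ_iff_forall.mpr h)
    simp only [mul_left_comm (x.coeff _)]
    rw [← Finset.mul_sum, lieElements_sum_ascents hx ρ t s hs, mul_zero]
  · simp

end KlyachkoIdem

theorem mainTheorem1 (K : Type*) [Field K] [CharZero K] (n : ℕ) (hn : 1 ≤ n) :
    KlyachkoIdem.IsLieIdempotent K n (KlyachkoIdem.klyachko K n) := by
  obtain ⟨m, rfl⟩ : ∃ m, n = m + 1 := ⟨n - 1, by omega⟩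
  refine ⟨?_, Set.ext fun y => ⟨?_, fun hy =>
    ⟨y, (KlyachkoIdem.mul_klyachko_of_mem_lieElements hy).symm⟩⟩⟩
  -- Idempotency is the fixing property applied to the Lie element `1 ⋉ e_n = e_n`.
  · apply KlyachkoIdem.mul_klyachko_of_mem_lieElements
    simpa using KlyachkoIdem.mul_klyachko_mem_lieElements K m 1
  · rintro ⟨x, rfl⟩
    exact KlyachkoIdem.mul_klyachko_mem_lieElements K m x

end
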